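/- Let $G$ be a finite group and $p$ a prime. Let $\mathcal{A}_p(G)$ be the poset of non-trivial elementary abelian $p$-subgroups of $G$ ordered by inclusion, let $\mathcal{A}_p(G)_n$ be the set of those isomorphic to $C_p^{n+1}$, and let $rk_p(G)$ be the largest rank of an elementary abelian $p$-subgroup of $G$. For a poset $\mathcal{P}$, $|\mathcal{P}|$ is the realization of its order complex $\Delta(\mathcal{P})$; its homology $H_*(|\mathcal{P}|;R)$ is computed by the simplicial chain complex $C_*(\Delta(\mathcal{P});R)$, with $C_n=\bigoplus_{p_0<\dots<p_n}R$ and $\partial=\sum_i(-1)^i\partial_i$, where $\partial_i$ deletes $p_i$. Choose any total order on the set of subgroups of order $p$ of $G$, and for $H\in\mathcal{A}_p(G)$ let $H^*$ be the smallest subgroup of order $p$ contained in $H$. Call a chain $\rho=\{W_0<W_1<\dots<W_n=H\}$ in $\mathcal{A}_p(G)$, with $W_i\cong C_p^{i+1}$, *admissible* (with top $H$) if $W_i$ does not contain $W_{i+1}^*$ for $0\le i<n$. For an admissible chain $\rho$ as above with $n\ge 1$ and $0\le i\le n$ let $\rho_i$ be the chain obtained by forgetting $W_i^*$: if $V_0,\dots,V_{n-1}$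 is the sequence $W_0^*,\dots,W_n^*$ with $W_i^*$ removed, then $\rho_i=\{V_0<\langle V_0,V_1\rangle<\dots<\langle V_0,\dots,V_{n-1}\rangle\}$. Then: 1. Each $\rho_i$ is again an admissible chain, and every $H\in\mathcal{A}_p(G)_n$ is the top of exactly $p^{n(n+1)/2}$ admissible chains. Hence the standard basis of $\bigoplus_{H\in\mathcal{A}_p(G)_n}R^{p^{n(n+1)/2}}$ can be indexed as $(b_\rho)$ by the admissible chains $\rho$ of length $n$, with $b_\rho$ in the summand of the top of $\rho$, by an indexing independent of $R$. 2. For every commutative ring $R$ with identity, the modules $\bigoplus_{H\in\mathcal{A}_p(G)_n}R^{p^{n(n+1)/2}}$, $n\ge0$, with the differential determined by $d(b_\rho)=\sum_{i=0}^n(-1)^i\,b_{\rho_i}$ ($n\ge 1$), form a chain complex, whose homology is isomorphic as an $R$-module to $H_n(|\mathcal{A}_p(G)|;R)$ in every degree $n$. 3. The Euler characteristic (alternating sum of the rational Betti numbers) is $$\chi(|\mathcal{A}_p(G)|)=\sum_{n=0}^{rk_p(G)-1}(-1)^n\,p^{\frac{n(n+1)}{2}}\,|\mathcal{A}_p(G)_n|.$$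 -/

import Mathlib

open CategoryTheory

universe u v

noncomputable section

/-! ### Simplicial homology of the order complex of a poset -/

/-- The `n`-simplices `p₀ < ⋯ < pₙ` of the order complex `Δ(P)` of a poset `P`. -/
abbrev OrderSimplex (P : Type u) [PartialOrder P] (n : ℕ) : Type u := Fin (n + 1) ↪o P

namespace OrderSimplex

variable {P : Type u} [PartialOrder P]

/-- The `i`-th face of a simplex: the vertex `pᵢ` is deleted. -/
def face {n : ℕ} (i : Fin (n + 2)) (s : OrderSimplex P (n + 1)) : OrderSimplex P n :=
  (Fin.succAboveOrderEmb i).trans s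

theorem face_face {n : ℕ} {i : Fin (n + 2)} {j : Fin (n + 3)} (h : j ≤ i.castSucc)
    (s : OrderSimplex P (n + 2)) :
    face i (face j s) = face (j.castLT (lt_of_le_of_lt h i.2)) (face i.succ s) := by
  ext k
  simp only [face, RelEmbedding.coe_trans, Function.comp_apply, Fin.succAboveOrderEmb_apply]
  congr 1
  ext
  simp only [Fin.succAbove, Fin.lt_def, Fin.le_def, Fin.val_castSucc] at h ⊢
  split_ifs <;> simp_all <;> omega

end OrderSimplex

/-- The simplicial boundary map `∂ = ∑ (-1)ⁱ ∂ᵢ` on the chains of the order complex of `P`. -/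
def orderBoundary (R : Type v) [CommRing R] (P : Type u) [PartialOrder P] (n : ℕ) :
    (OrderSimplex P (n + 1) →₀ R) →ₗ[R] (OrderSimplex P n →₀ R) :=
  ∑ i : Fin (n + 2), (-1 : R) ^ (i : ℕ) • Finsupp.lmapDomain R R (OrderSimplex.face i)

theorem orderBoundary_comp (R : Type v) [CommRing R] (P : Type u) [PartialOrder P] (n : ℕ) :
    orderBoundary R P n ∘ₗ orderBoundary R P (n + 1) = 0 := by
  apply Finsupp.lhom_ext
  intro s r
  simp only [orderBoundary, LinearMap.comp_apply, LinearMap.sum_apply, map_sum,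
    LinearMap.smul_apply, map_smul, Finsupp.lmapDomain_apply, Finsupp.mapDomain_single,
    Finset.smul_sum, LinearMap.zero_apply]
  rw [Finset.sum_comm]
  simp only [← Finset.sum_product']
  let Q := Fin (n + 2) × Fin (n + 3)
  let S : Finset Q := {ij : Q | (ij.2 : ℕ) ≤ (ij.1 : ℕ)}
  rw [Finset.univ_product_univ, ← Finset.sum_add_sum_compl S, ← eq_neg_iff_add_eq_zero,
    ← Finset.sum_neg_distrib]
  let φ : ∀ ij : Q, ij ∈ S → Q := fun ij hij =>
    (Fin.castLT ij.2 (lt_of_le_of_lt (Finset.mem_filter.mp hij).right (Fin.is_lt ij.1)), ij.1.succ)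
  apply Finset.sum_bij φ
  · intro ij hij
    simp_rw [S, φ, Finset.compl_filter, Finset.mem_filter_univ, Fin.val_succ,
      Fin.val_castLT] at hij ⊢
    lia
  · rintro ⟨i, j⟩ hij ⟨i', j'⟩ hij' h
    rw [Prod.mk_inj]
    exact ⟨by simpa [φ] using! congr_arg Prod.snd h,
      by simpa [φ, Fin.castSucc_castLT] using! congr_arg Fin.castSucc (congr_arg Prod.fst h)⟩
  · rintro ⟨i', j'⟩ hij'
    simp_rw [S, Finset.compl_filter, Finset.mem_filter_univ, not_le] at hij'
    refine ⟨(j'.pred <| ?_, Fin.castSucc i'), ?_, ?_⟩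
    · rintro rfl
      simp only [Fin.val_zero, not_lt_zero] at hij'
    · simpa [S] using! Nat.le_sub_one_of_lt hij'
    · simp only [φ, Fin.castLT_castSucc, Fin.succ_pred]
  · rintro ⟨i, j⟩ hij
    have hij' : j ≤ i.castSucc := by simpa [S, Fin.le_def] using hij
    simp only [φ, OrderSimplex.face_face hij', smul_smul, ← neg_smul]
    congr 1
    simp only [Fin.val_succ, Fin.val_castLT]
    ring

/-- The (unaugmented) simplicial chain complex `C_*(Δ(P); R)` of the order complex of `P`. Its
homology is `H_*(|P|; R)`. -/
def orderChainComplex (R : Type v) [CommRing R] (P : Type u) [PartialOrder P] :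
    ChainComplex (ModuleCat.{max u v} R) ℕ :=
  ChainComplex.of (fun n => ModuleCat.of R (OrderSimplex P n →₀ R))
    (fun n => ModuleCat.ofHom (orderBoundary R P n))
    (fun n => by rw [← ModuleCat.ofHom_comp, orderBoundary_comp]; rfl)

/-- The Euler characteristic of `|P|`: the alternating sum of the rational Betti numbers. -/
def posetEulerChar (P : Type u) [PartialOrder P] : ℤ :=
  (orderChainComplex ℚ P).homologyEulerChar

/-! ### Quillen's poset -/

/-- `H` is an elementary abelian `p`-subgroup of `G` (possibly trivial). -/
def IsElemAbelian (p : ℕ) {G : Type u} [Group G] (H : Subgroup G) : Prop :=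
  (∀ x ∈ H, ∀ y ∈ H, x * y = y * x) ∧ ∀ x ∈ H, x ^ p = 1

/-- `A_p(G)`: the non-trivial elementary abelian `p`-subgroups of `G`, ordered by inclusion. -/
abbrev QuillenPoset (p : ℕ) (G : Type u) [Group G] : Type u :=
  {H : Subgroup G // H ≠ ⊥ ∧ IsElemAbelian p H}

/-- `A_p(G)_n`: the elements of dimension `n`, that is, of rank `n + 1`. (An elementary abelian
`p`-group has rank `r` iff it has order `p ^ r`.) -/
abbrev QuillenDim (p : ℕ) (G : Type u) [Group G] (n : ℕ) : Type u :=
  {H : QuillenPoset p G // Nat.card H.1 = p ^ (n + 1)}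

/-- The `p`-rank of `G`: the largest rank of an elementary abelian `p`-subgroup. -/
def pRank (p : ℕ) (G : Type u) [Group G] : ℕ :=
  sSup {r : ℕ | ∃ H : Subgroup G, IsElemAbelian p H ∧ Nat.card H = p ^ r}

/-- The subgroups of order `p` of `G`. This is not an `abbrev`, so that inclusion is not taken as
its order: it is going to carry an arbitrary total order. -/
def OrderPSubgroup (p : ℕ) (G : Type u) [Group G] : Type u :=
  {V : Subgroup G // Nat.card V = p}

section Star

variable {p : ℕ} [Fact p.Prime] {G : Type u} [Group G] [Finite G] [LinearOrder (OrderPSubgroup p G)]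

theorem QuillenPoset.exists_isLeast (H : QuillenPoset p G) :
    ∃ V : OrderPSubgroup p G, IsLeast {V : OrderPSubgroup p G | V.1 ≤ H.1} V := by
  have : Finite (OrderPSubgroup p G) :=
    inferInstanceAs (Finite {V : Subgroup G // Nat.card V = p})
  have hne : {V : OrderPSubgroup p G | V.1 ≤ H.1}.Nonempty := by
    obtain ⟨y, hy⟩ := Subgroup.ne_bot_iff_exists_ne_one.mp H.2.1
    obtain ⟨x, hx, hx1⟩ : ∃ x : G, x ∈ H.1 ∧ x ≠ 1 := ⟨y.1, y.2, fun h => hy (Subtype.ext h)⟩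
    refine ⟨⟨Subgroup.zpowers x, ?_⟩, ?_⟩
    · rw [Nat.card_zpowers]
      exact orderOf_eq_prime (H.2.2.2 x hx) hx1
    · exact (Subgroup.zpowers_le).mpr hx
  obtain ⟨V, hV, hmin⟩ := Set.exists_min_image _ id (Set.toFinite _) hne
  exact ⟨V, hV, fun W hW => hmin W hW⟩

/-- `H^*`: the smallest subgroup of order `p` contained in `H`, for the chosen total order. -/
def QuillenPoset.star (H : QuillenPoset p G) : OrderPSubgroup p G :=
  H.exists_isLeast.choose

end Star

/-- The chains `W₀ < W₁ < ⋯ < Wₙ` in `A_p(G)` with `dim Wᵢ = i` such that `Wᵢ` does not contain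
`(Wᵢ₊₁)^*`. -/
@[ext]
structure AdmissibleChain (p : ℕ) [Fact p.Prime] (G : Type u) [Group G] [Finite G]
    [LinearOrder (OrderPSubgroup p G)] (n : ℕ) : Type u where
  /-- the terms of the chain -/
  W : Fin (n + 1) → QuillenPoset p G
  strictMono : StrictMono W
  card_eq : ∀ i, Nat.card (W i).1 = p ^ ((i : ℕ) + 1)
  not_star_le : ∀ i : Fin n, ¬ (W i.succ).star.1 ≤ (W i.castSucc).1

/-- The top `Wₙ` of an admissible chain. -/
def AdmissibleChain.top {p : ℕ} [Fact p.Prime] {G : Type u} [Group G] [Finite G]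
    [LinearOrder (OrderPSubgroup p G)] {n : ℕ} (ρ : AdmissibleChain p G n) : QuillenDim p G n :=
  ⟨ρ.W (Fin.last n), by simpa using ρ.card_eq (Fin.last n)⟩

/-- The `R`-module `⨁_{H ∈ A_p(G)_n} R^{p^{n(n+1)/2}}`. -/
abbrev QuillenChains (R : Type v) [CommRing R] (p : ℕ) (G : Type u) [Group G] (n : ℕ) :
    Type (max u v) :=
  DirectSum (QuillenDim p G n) fun _ => Fin (p ^ (n * (n + 1) / 2)) → R

open scoped Classical in
/-- The standard basis vector number `k` of the summand of `⨁_{H ∈ A_p(G)_n} R^{p^{n(n+1)/2}}`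
at `H`. -/
def quillenBasis (R : Type v) [CommRing R] (p : ℕ) (G : Type u) [Group G] (n : ℕ)
    (x : (_ : QuillenDim p G n) × Fin (p ^ (n * (n + 1) / 2))) : QuillenChains R p G n :=
  DirectSum.lof R (QuillenDim p G n) (fun _ => Fin (p ^ (n * (n + 1) / 2)) → R) x.1
    (Pi.single x.2 1)

end

noncomputable section

/-! ### Simplicial chains of an abstract family of simplices -/

/-- A family of simplices with ordered, pairwise distinct vertices in `T`, determined by their
vertices and closed under faces. -/
structure SimplexFamily (T : Type*) where
  /-- the `n`-simplices -/
  X : ℕ → Type u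
  /-- the vertices of a simplex -/
  vert : ∀ {n : ℕ}, X n → Fin (n + 1) → T
  vert_injective : ∀ {n : ℕ} (x : X n), Function.Injective (vert x)
  ext_vert : ∀ {n : ℕ} {x y : X n}, (∀ k, vert x k = vert y k) → x = y
  /-- the face obtained by deleting the `i`-th vertex -/
  face : ∀ {n : ℕ}, Fin (n + 2) → X (n + 1) → X n
  vert_face : ∀ {n : ℕ} (i : Fin (n + 2)) (x : X (n + 1)) (k : Fin (n + 1)),
    vert (face i x) k = vert x (i.succAbove k)

namespace SimplexFamily

variable {T : Type*} (S : SimplexFamily.{u} T)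

theorem face_face {n : ℕ} {i : Fin (n + 2)} {j : Fin (n + 3)} (h : j ≤ i.castSucc)
    (x : S.X (n + 2)) :
    S.face i (S.face j x) = S.face (j.castLT (lt_of_le_of_lt h i.2)) (S.face i.succ x) := by
  refine S.ext_vert fun k => ?_
  simp only [S.vert_face]
  -- The identity concerns coface maps only, so it is read off from the full simplex of `Fin (n +
  -- 3)`.
  exact congrArg (S.vert x) (congrArg (fun s : OrderSimplex (Fin (n + 3)) n => s k)
    (OrderSimplex.face_face h (RelEmbedding.refl _)))

theorem ext_last {n : ℕ} {x y : S.X (n + 1)}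
    (h : S.face (Fin.last (n + 1)) x = S.face (Fin.last (n + 1)) y)
    (hl : S.vert x (Fin.last (n + 1)) = S.vert y (Fin.last (n + 1))) : x = y := by
  refine S.ext_vert fun k => ?_
  induction k using Fin.lastCases with
  | last => exact hl
  | cast k => simpa [S.vert_face] using congrArg (fun z => S.vert z k) h

variable (R : Type v) [CommRing R]

/-- The simplicial boundary map `∑ (-1)ⁱ ∂ᵢ`. -/
def boundary (n : ℕ) : (S.X (n + 1) →₀ R) →ₗ[R] (S.X n →₀ R) :=
  ∑ i : Fin (n + 2), (-1 : R) ^ (i : ℕ) • Finsupp.lmapDomain R R (S.face i)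

theorem boundary_single {n : ℕ} (x : S.X (n + 1)) (r : R) :
    S.boundary R n (Finsupp.single x r) =
      ∑ i : Fin (n + 2), (-1 : R) ^ (i : ℕ) • Finsupp.single (S.face i x) r := by
  simp [boundary, LinearMap.sum_apply]

theorem boundary_comp (n : ℕ) : S.boundary R n ∘ₗ S.boundary R (n + 1) = 0 := by
  apply Finsupp.lhom_ext
  intro s r
  simp only [boundary_single, LinearMap.comp_apply, map_sum, map_smul, Finset.smul_sum,
    LinearMap.zero_apply]
  rw [Finset.sum_comm]
  simp only [← Finset.sum_product']
  let Q := Fin (n + 2) × Fin (n + 3)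
  let A : Finset Q := {ij : Q | (ij.2 : ℕ) ≤ (ij.1 : ℕ)}
  rw [Finset.univ_product_univ, ← Finset.sum_add_sum_compl A, ← eq_neg_iff_add_eq_zero,
    ← Finset.sum_neg_distrib]
  -- The pairs `(i, j)` with `j ≤ i` and their images `(j, i + 1)` give the same double face with
  -- opposite signs.
  let φ : ∀ ij : Q, ij ∈ A → Q := fun ij hij =>
    (Fin.castLT ij.2 (lt_of_le_of_lt (Finset.mem_filter.mp hij).right (Fin.is_lt ij.1)), ij.1.succ)
  apply Finset.sum_bij φ
  · intro ij hij
    simp_rw [A, φ, Finset.compl_filter, Finset.mem_filter_univ, Fin.val_succ,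
      Fin.val_castLT] at hij ⊢
    lia
  · rintro ⟨i, j⟩ hij ⟨i', j'⟩ hij' h
    rw [Prod.mk_inj]
    exact ⟨by simpa [φ] using! congr_arg Prod.snd h,
      by simpa [φ, Fin.castSucc_castLT] using! congr_arg Fin.castSucc (congr_arg Prod.fst h)⟩
  · rintro ⟨i', j'⟩ hij'
    simp_rw [A, Finset.compl_filter, Finset.mem_filter_univ, not_le] at hij'
    refine ⟨(j'.pred <| ?_, Fin.castSucc i'), ?_, ?_⟩
    · rintro rfl
      simp only [Fin.val_zero, not_lt_zero] at hij'
    · simpa [A] using! Nat.le_sub_one_of_lt hij'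
    · simp only [φ, Fin.castLT_castSucc, Fin.succ_pred]
  · rintro ⟨i, j⟩ hij
    have hij' : j ≤ i.castSucc := by simpa [A, Fin.le_def] using hij
    simp only [φ, S.face_face hij', smul_smul, ← neg_smul]
    congr 1
    simp only [Fin.val_succ, Fin.val_castLT]
    ring

theorem boundary_boundary {n : ℕ} (z : S.X (n + 2) →₀ R) :
    S.boundary R n (S.boundary R (n + 1) z) = 0 :=
  LinearMap.congr_fun (S.boundary_comp R n) z

/-- The augmentation of the chains. -/
def aug : (S.X 0 →₀ R) →ₗ[R] R := Finsupp.linearCombination R fun _ => (1 : R)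

@[simp]
theorem aug_single (x : S.X 0) (r : R) : S.aug R (Finsupp.single x r) = r := by
  simp [aug]

theorem aug_boundary (z : S.X 1 →₀ R) : S.aug R (S.boundary R 0 z) = 0 := by
  suffices S.aug R ∘ₗ S.boundary R 0 = 0 from LinearMap.congr_fun this z
  apply Finsupp.lhom_ext
  intro x r
  rw [LinearMap.comp_apply, boundary_single, map_sum]
  simp only [map_smul, aug_single]
  rw [Fin.sum_univ_two]
  simp

end SimplexFamily

/-! ### Acyclic carriers -/

/-- A family of simplices, each with a carrier in `P`, such that for every `H : P` the simplices
with carrier at most `H` form a cone whose apex can be taken as the last vertex. -/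
structure CarriedFamily (T : Type*) (P : Type*) [Preorder P] extends SimplexFamily.{u} T where
  /-- the carrier of a simplex -/
  carrier : ∀ {n : ℕ}, X n → P
  carrier_face : ∀ {n : ℕ} (i : Fin (n + 2)) (x : X (n + 1)), carrier (face i x) ≤ carrier x
  /-- the apex of the cone of simplices with carrier at most `H` -/
  apex : P → T
  exists_vertex : ∀ H : P, ∃ x : X 0, carrier x ≤ H ∧ vert x 0 = apex H
  exists_cone : ∀ (H : P) {n : ℕ} (x : X n), carrier x ≤ H → vert x (Fin.last n) ≠ apex H →
    ∃ y : X (n + 1), carrier y ≤ H ∧ face (Fin.last (n + 1)) y = x ∧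
      vert y (Fin.last (n + 1)) = apex H

namespace CarriedFamily

variable {T : Type*} {P : Type*} [Preorder P] (S : CarriedFamily.{u} T P)
variable (R : Type v) [CommRing R]

/-- The chains supported on simplices with carrier at most `H`. -/
def sub (n : ℕ) (H : P) : Submodule R (S.X n →₀ R) :=
  Finsupp.supported R R {x | S.carrier x ≤ H}

variable {R}

theorem single_mem_sub {n : ℕ} {H : P} {x : S.X n} (h : S.carrier x ≤ H) (r : R) :
    Finsupp.single x r ∈ S.sub R n H :=
  Finsupp.single_mem_supported R r h

theorem sub_mono {n : ℕ} {H K : P} (h : H ≤ K) : S.sub R n H ≤ S.sub R n K :=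
  Finsupp.supported_mono fun _ hx => le_trans hx h

/-- Reduces statements about carried chains to basis simplices; `N` will be a preimage or the
equalizer of two linear maps. -/
theorem sub_le_iff {n : ℕ} {H : P} {N : Submodule R (S.X n →₀ R)} :
    S.sub R n H ≤ N ↔ ∀ x : S.X n, S.carrier x ≤ H → Finsupp.single x 1 ∈ N := by
  rw [sub, Finsupp.supported_eq_span_single, Submodule.span_le]
  simp [Set.subset_def]

theorem boundary_mem {n : ℕ} {H : P} {z : S.X (n + 1) →₀ R} (hz : z ∈ S.sub R (n + 1) H) :
    S.boundary R n z ∈ S.sub R n H := by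
  suffices S.sub R (n + 1) H ≤ (S.sub R n H).comap (S.boundary R n) from this hz
  rw [sub_le_iff]
  intro x hx
  rw [Submodule.mem_comap, SimplexFamily.boundary_single]
  exact Submodule.sum_mem _ fun i _ => Submodule.smul_mem _ _
    (S.single_mem_sub ((S.carrier_face i x).trans hx) 1)

variable (R)

open scoped Classical in
/-- The operator that appends the apex of `H` to a simplex, up to sign. -/
def cone (H : P) (n : ℕ) : (S.X n →₀ R) →ₗ[R] (S.X (n + 1) →₀ R) :=
  Finsupp.linearCombination R fun x =>
    if h : ∃ y : S.X (n + 1), S.carrier y ≤ H ∧ S.face (Fin.last (n + 1)) y = x ∧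
      S.vert y (Fin.last (n + 1)) = S.apex H
    then (-1 : R) ^ (n + 1) • Finsupp.single h.choose 1 else 0

/-- The simplex whose only vertex is the apex of `H`. -/
def vertex (H : P) : S.X 0 := (S.exists_vertex H).choose

variable {R}

theorem carrier_vertex (H : P) : S.carrier (S.vertex H) ≤ H := (S.exists_vertex H).choose_spec.1

theorem eq_vertex {H : P} {x : S.X 0} (h : S.vert x 0 = S.apex H) : x = S.vertex H :=
  S.ext_vert fun k => by
    rw [Fin.fin_one_eq_zero k, h, vertex, (S.exists_vertex H).choose_spec.2]

/-- A simplex is determined by its last face and last vertex, so the choice made in `cone` has only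
one possible outcome. -/
theorem cone_single {H : P} {n : ℕ} {y : S.X (n + 1)} (hy : S.carrier y ≤ H)
    (hl : S.vert y (Fin.last (n + 1)) = S.apex H) :
    S.cone R H n (Finsupp.single (S.face (Fin.last (n + 1)) y) 1) =
      (-1 : R) ^ (n + 1) • Finsupp.single y 1 := by
  have h : ∃ y' : S.X (n + 1), S.carrier y' ≤ H ∧
      S.face (Fin.last (n + 1)) y' = S.face (Fin.last (n + 1)) y ∧
      S.vert y' (Fin.last (n + 1)) = S.apex H := ⟨y, hy, rfl, hl⟩
  rw [cone, Finsupp.linearCombination_single, dif_pos h, one_smul,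
    S.ext_last h.choose_spec.2.1 (h.choose_spec.2.2.trans hl.symm)]

/-- Vertices are distinct, so the apex cannot be appended twice and the default value 0 applies. -/
theorem cone_single_eq_zero {H : P} {n : ℕ} {x : S.X n}
    (hl : S.vert x (Fin.last n) = S.apex H) : S.cone R H n (Finsupp.single x 1) = 0 := by
  rw [cone, Finsupp.linearCombination_single, dif_neg, smul_zero]
  rintro ⟨y, -, rfl, h⟩
  rw [S.vert_face, ← h] at hl
  exact absurd (S.vert_injective y hl) (Fin.succAbove_ne _ _)

theorem cone_mem {H : P} {n : ℕ} (z : S.X n →₀ R) : S.cone R H n z ∈ S.sub R (n + 1) H := by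
  induction z using Finsupp.induction_linear with
  | zero => simp
  | add a b ha hb => rw [map_add]; exact add_mem ha hb
  | single x r =>
    rw [cone, Finsupp.linearCombination_single]
    refine Submodule.smul_mem _ _ ?_
    split_ifs with h
    · exact Submodule.smul_mem _ _ (S.single_mem_sub h.choose_spec.1 1)
    · exact zero_mem _

theorem boundary_cone_zero {H : P} {z : S.X 0 →₀ R} (hz : z ∈ S.sub R 0 H) :
    S.boundary R 0 (S.cone R H 0 z) + S.aug R z • Finsupp.single (S.vertex H) 1 = z := by
  suffices S.sub R 0 H ≤ LinearMap.eqLocus (S.boundary R 0 ∘ₗ S.cone R H 0 +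
      (S.aug R).smulRight (Finsupp.single (S.vertex H) 1)) LinearMap.id from this hz
  rw [sub_le_iff]
  intro x hx
  simp only [LinearMap.mem_eqLocus, LinearMap.add_apply, LinearMap.comp_apply,
    LinearMap.smulRight_apply, SimplexFamily.aug_single, one_smul, LinearMap.id_apply]
  by_cases hl : S.vert x 0 = S.apex H
  · rw [S.cone_single_eq_zero hl, map_zero, zero_add, S.eq_vertex hl]
  · obtain ⟨y, hy, rfl, hyl⟩ := S.exists_cone H x hx hl
    rw [S.cone_single hy hyl, map_smul, SimplexFamily.boundary_single, Fin.sum_univ_two,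
      S.eq_vertex (x := S.face 0 y) (by rw [S.vert_face]; exact hyl)]
    simp [show Fin.last 1 = 1 from rfl]

/-- With `boundary_cone_zero`, `cone` contracts the augmented complex of simplices carried by `H`.
Its sign cancels that of the face deleting the apex. -/
theorem boundary_cone_succ {H : P} {n : ℕ} {z : S.X (n + 1) →₀ R} (hz : z ∈ S.sub R (n + 1) H) :
    S.boundary R (n + 1) (S.cone R H (n + 1) z) + S.cone R H n (S.boundary R n z) = z := by
  suffices S.sub R (n + 1) H ≤ LinearMap.eqLocus (S.boundary R (n + 1) ∘ₗ S.cone R H (n + 1) +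
      S.cone R H n ∘ₗ S.boundary R n) LinearMap.id from this hz
  rw [sub_le_iff]
  intro x hx
  simp only [LinearMap.mem_eqLocus, LinearMap.add_apply, LinearMap.comp_apply, LinearMap.id_apply]
  have hlast (m : ℕ) (i : Fin (m + 1)) :
      i.castSucc.succAbove (Fin.last m) = Fin.last (m + 1) := by
    rw [Fin.succAbove_of_le_castSucc _ _ (by simpa using Fin.le_last i), Fin.succ_last]
  -- If `x` ends in the apex, only its last face has a nonzero cone, namely `x` up to sign.
  -- Otherwise the faces of the cone that keep the apex cancel against the cones of the faces of
  -- `x`.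
  by_cases hl : S.vert x (Fin.last (n + 1)) = S.apex H
  · rw [S.cone_single_eq_zero hl, map_zero, zero_add, SimplexFamily.boundary_single, map_sum,
      Fin.sum_univ_castSucc, Finset.sum_eq_zero, zero_add, map_smul, S.cone_single hx hl, smul_smul,
      Fin.val_last, ← pow_add, Even.neg_one_pow ⟨_, rfl⟩, one_smul]
    intro i _
    rw [map_smul, S.cone_single_eq_zero, smul_zero]
    rw [S.vert_face, hlast, hl]
  · obtain ⟨y, hy, rfl, hyl⟩ := S.exists_cone H x hx hl
    rw [S.cone_single hy hyl, map_smul, SimplexFamily.boundary_single, Fin.sum_univ_castSucc,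
      SimplexFamily.boundary_single, map_sum, smul_add, smul_smul, Fin.val_last, ← pow_add,
      Even.neg_one_pow ⟨_, rfl⟩, one_smul, add_right_comm, add_eq_right, Finset.smul_sum,
      ← Finset.sum_add_distrib]
    refine Finset.sum_eq_zero fun i _ => ?_
    have hf : S.face i (S.face (Fin.last (n + 2)) y) =
        S.face (Fin.last (n + 1)) (S.face i.castSucc y) := by
      rw [S.face_face (i := Fin.last (n + 1)) (j := i.castSucc)
        (Fin.castSucc_le_castSucc_iff.2 (Fin.le_last i))]
      simp
    rw [map_smul, hf, S.cone_single ((S.carrier_face _ _).trans hy)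
      (by rw [S.vert_face, hlast, hyl]), smul_smul, smul_smul, ← add_smul, Fin.val_castSucc,
      pow_succ _ (n + 1)]
    convert zero_smul R _ using 2
    ring

variable {T' : Type*} (S' : CarriedFamily.{u} T' P)

variable (R) in
/-- The carrier-preserving chain map between two carried families. -/
def compMap : ∀ n : ℕ, (S.X n →₀ R) →ₗ[R] (S'.X n →₀ R)
  | 0 => Finsupp.linearCombination R fun x => Finsupp.single (S'.vertex (S.carrier x)) 1
  | n + 1 => Finsupp.linearCombination R fun x =>
      S'.cone R (S.carrier x) n (compMap n (S.boundary R n (Finsupp.single x 1)))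

theorem compMap_succ_single (n : ℕ) (x : S.X (n + 1)) :
    S.compMap R S' (n + 1) (Finsupp.single x 1) =
      S'.cone R (S.carrier x) n (S.compMap R S' n (S.boundary R n (Finsupp.single x 1))) := by
  rw [compMap, Finsupp.linearCombination_single, one_smul]

theorem compMap_mem {n : ℕ} {H : P} {z : S.X n →₀ R} (hz : z ∈ S.sub R n H) :
    S.compMap R S' n z ∈ S'.sub R n H := by
  suffices S.sub R n H ≤ (S'.sub R n H).comap (S.compMap R S' n) from this hz
  rw [sub_le_iff]
  intro x hx
  rw [Submodule.mem_comap]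
  cases n with
  | zero =>
    rw [compMap, Finsupp.linearCombination_single, one_smul]
    exact S'.single_mem_sub ((S'.carrier_vertex _).trans hx) 1
  | succ n =>
    rw [compMap, Finsupp.linearCombination_single, one_smul]
    exact S'.sub_mono hx (S'.cone_mem _)

theorem aug_compMap (z : S.X 0 →₀ R) : S'.aug R (S.compMap R S' 0 z) = S.aug R z := by
  suffices S'.aug R ∘ₗ S.compMap R S' 0 = S.aug R from LinearMap.congr_fun this z
  apply Finsupp.lhom_ext
  intro x r
  simp [compMap]

/-- The image of the boundary of `x` is a cycle by induction (of augmentation zero in degree 0)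
carried by the carrier of `x`, and coning off a cycle fills it. -/
theorem boundary_compMap (n : ℕ) (z : S.X (n + 1) →₀ R) :
    S'.boundary R n (S.compMap R S' (n + 1) z) = S.compMap R S' n (S.boundary R n z) := by
  have hmem (n : ℕ) (x : S.X (n + 1)) :
      S.compMap R S' n (S.boundary R n (Finsupp.single x 1)) ∈ S'.sub R n (S.carrier x) :=
    S.compMap_mem S' (S.boundary_mem (S.single_mem_sub le_rfl 1))
  induction n with
  | zero =>
    suffices S'.boundary R 0 ∘ₗ S.compMap R S' 1 = S.compMap R S' 0 ∘ₗ S.boundary R 0 from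
      LinearMap.congr_fun this z
    ext x : 2
    simp only [LinearMap.comp_apply, Finsupp.lsingle_apply]
    have h := S'.boundary_cone_zero (hmem 0 x)
    rw [aug_compMap, SimplexFamily.aug_boundary, zero_smul, add_zero] at h
    rw [compMap_succ_single, h]
  | succ n ih =>
    suffices S'.boundary R (n + 1) ∘ₗ S.compMap R S' (n + 2) =
      S.compMap R S' (n + 1) ∘ₗ S.boundary R (n + 1) from LinearMap.congr_fun this z
    ext x : 2
    simp only [LinearMap.comp_apply, Finsupp.lsingle_apply]
    have h := S'.boundary_cone_succ (hmem (n + 1) x)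
    rw [ih, SimplexFamily.boundary_boundary, map_zero, map_zero, add_zero] at h
    rw [compMap_succ_single, h]

/-- The null-homotopy of a carrier-preserving chain map that vanishes after augmentation. -/
def nullHomotopy (k : ∀ n : ℕ, (S.X n →₀ R) →ₗ[R] (S'.X n →₀ R)) :
    ∀ n : ℕ, (S.X n →₀ R) →ₗ[R] (S'.X (n + 1) →₀ R)
  | 0 => Finsupp.linearCombination R fun x => S'.cone R (S.carrier x) 0 (k 0 (Finsupp.single x 1))
  | n + 1 => Finsupp.linearCombination R fun x =>
      S'.cone R (S.carrier x) (n + 1) (k (n + 1) (Finsupp.single x 1) -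
        nullHomotopy k n (S.boundary R n (Finsupp.single x 1)))

section

variable {k : ∀ n : ℕ, (S.X n →₀ R) →ₗ[R] (S'.X n →₀ R)}

theorem nullHomotopy_succ_single (n : ℕ) (x : S.X (n + 1)) :
    S.nullHomotopy S' k (n + 1) (Finsupp.single x 1) =
      S'.cone R (S.carrier x) (n + 1) (k (n + 1) (Finsupp.single x 1) -
        S.nullHomotopy S' k n (S.boundary R n (Finsupp.single x 1))) := by
  rw [nullHomotopy, Finsupp.linearCombination_single, one_smul]

theorem nullHomotopy_mem {n : ℕ} {H : P} {z : S.X n →₀ R} (hz : z ∈ S.sub R n H) :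
    S.nullHomotopy S' k n z ∈ S'.sub R (n + 1) H := by
  suffices S.sub R n H ≤ (S'.sub R (n + 1) H).comap (S.nullHomotopy S' k n) from this hz
  rw [sub_le_iff]
  intro x hx
  rw [Submodule.mem_comap]
  cases n <;>
  · rw [nullHomotopy, Finsupp.linearCombination_single, one_smul]
    exact S'.sub_mono hx (S'.cone_mem _)

theorem boundary_nullHomotopy_zero
    (hk : ∀ (n : ℕ) (x : S.X n), k n (Finsupp.single x 1) ∈ S'.sub R n (S.carrier x))
    (haug : ∀ z, S'.aug R (k 0 z) = 0) (z : S.X 0 →₀ R) :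
    S'.boundary R 0 (S.nullHomotopy S' k 0 z) = k 0 z := by
  suffices S'.boundary R 0 ∘ₗ S.nullHomotopy S' k 0 = k 0 from LinearMap.congr_fun this z
  ext x : 2
  simp only [LinearMap.comp_apply, Finsupp.lsingle_apply]
  have h := S'.boundary_cone_zero (hk 0 x)
  rw [haug, zero_smul, add_zero] at h
  rwa [nullHomotopy, Finsupp.linearCombination_single, one_smul]

/-- By induction `k x - h ∂x` is a cycle carried by the carrier of `x`, where `h` is the homotopy
one degree lower; its cone therefore fills it. -/
theorem boundary_nullHomotopy_succ
    (hk : ∀ (n : ℕ) (x : S.X n), k n (Finsupp.single x 1) ∈ S'.sub R n (S.carrier x))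
    (haug : ∀ z, S'.aug R (k 0 z) = 0)
    (hcomm : ∀ n z, S'.boundary R n (k (n + 1) z) = k n (S.boundary R n z))
    (n : ℕ) (z : S.X (n + 1) →₀ R) :
    S'.boundary R (n + 1) (S.nullHomotopy S' k (n + 1) z) +
      S.nullHomotopy S' k n (S.boundary R n z) = k (n + 1) z := by
  induction n with
  | zero =>
    suffices S'.boundary R 1 ∘ₗ S.nullHomotopy S' k 1 +
      S.nullHomotopy S' k 0 ∘ₗ S.boundary R 0 = k 1 from LinearMap.congr_fun this z
    ext x : 2
    simp only [LinearMap.comp_apply, Finsupp.lsingle_apply, LinearMap.add_apply]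
    have h := S'.boundary_cone_succ (sub_mem (hk 1 x)
      (S.nullHomotopy_mem S' (k := k) (S.boundary_mem (S.single_mem_sub (le_refl _) 1))))
    rw [map_sub (S'.boundary R 0), hcomm, S.boundary_nullHomotopy_zero S' hk haug, sub_self, map_zero, add_zero] at h
    rw [nullHomotopy_succ_single, h, sub_add_cancel]
  | succ n ih =>
    suffices S'.boundary R (n + 2) ∘ₗ S.nullHomotopy S' k (n + 2) +
      S.nullHomotopy S' k (n + 1) ∘ₗ S.boundary R (n + 1) = k (n + 2) from
        LinearMap.congr_fun this z
    ext x : 2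
    simp only [LinearMap.comp_apply, Finsupp.lsingle_apply, LinearMap.add_apply]
    have h := S'.boundary_cone_succ (sub_mem (hk (n + 2) x)
      (S.nullHomotopy_mem S' (k := k) (S.boundary_mem (S.single_mem_sub (le_refl _) 1))))
    have h2 := ih (S.boundary R (n + 1) (Finsupp.single x 1))
    rw [SimplexFamily.boundary_boundary, map_zero, add_zero] at h2
    rw [map_sub (S'.boundary R (n + 1)), hcomm, h2, sub_self, map_zero, add_zero] at h
    rw [nullHomotopy_succ_single, h, sub_add_cancel]

end

end CarriedFamily

/-! ### From linear maps to isomorphisms in homology -/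

/-- Chain maps that are inverse to each other up to homotopy, given degreewise by linear maps,
induce an isomorphism in homology. -/
theorem nonempty_homology_iso_of_linear_homotopy {R : Type v} [CommRing R]
    {M N : ℕ → Type (max u v)}
    [∀ n, AddCommGroup (M n)] [∀ n, Module R (M n)] [∀ n, AddCommGroup (N n)]
    [∀ n, Module R (N n)] (dM : ∀ n, M (n + 1) →ₗ[R] M n) (dN : ∀ n, N (n + 1) →ₗ[R] N n)
    (hM : ∀ n, ModuleCat.ofHom (dM (n + 1)) ≫ ModuleCat.ofHom (dM n) = 0)
    (hN : ∀ n, ModuleCat.ofHom (dN (n + 1)) ≫ ModuleCat.ofHom (dN n) = 0)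
    (f : ∀ n, M n →ₗ[R] N n) (g : ∀ n, N n →ₗ[R] M n)
    (hf : ∀ n z, dN n (f (n + 1) z) = f n (dM n z)) (hg : ∀ n z, dM n (g (n + 1) z) = g n (dN n z))
    (s : ∀ n, M n →ₗ[R] M (n + 1)) (t : ∀ n, N n →ₗ[R] N (n + 1))
    (hs0 : ∀ z, dM 0 (s 0 z) = g 0 (f 0 z) - z)
    (hs : ∀ n z, dM (n + 1) (s (n + 1) z) + s n (dM n z) = g (n + 1) (f (n + 1) z) - z)
    (ht0 : ∀ z, dN 0 (t 0 z) = f 0 (g 0 z) - z)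
    (ht : ∀ n z, dN (n + 1) (t (n + 1) z) + t n (dN n z) = f (n + 1) (g (n + 1) z) - z) (n : ℕ) :
    Nonempty ((ChainComplex.of (fun n => ModuleCat.of R (M n)) (fun n => ModuleCat.ofHom (dM n))
        hM).homology n ≅
      (ChainComplex.of (fun n => ModuleCat.of R (N n)) (fun n => ModuleCat.ofHom (dN n))
        hN).homology n) := by
  let C := ChainComplex.of (fun n => ModuleCat.of R (M n)) (fun n => ModuleCat.ofHom (dM n)) hM
  let D := ChainComplex.of (fun n => ModuleCat.of R (N n)) (fun n => ModuleCat.ofHom (dN n)) hN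
  have hC (n : ℕ) : C.d (n + 1) n = ModuleCat.ofHom (dM n) :=
    ChainComplex.of_d (fun n => ModuleCat.of R (M n)) (fun n => ModuleCat.ofHom (dM n)) n
  have hD (n : ℕ) : D.d (n + 1) n = ModuleCat.ofHom (dN n) :=
    ChainComplex.of_d (fun n => ModuleCat.of R (N n)) (fun n => ModuleCat.ofHom (dN n)) n
  let F : C ⟶ D := ChainComplex.ofHom (fun n => ModuleCat.ofHom (f n)) fun n => by
    rw [hC, hD]
    ext z
    exact hf n z
  let G : D ⟶ C := ChainComplex.ofHom (fun n => ModuleCat.ofHom (g n)) fun n => by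
    rw [hC, hD]
    ext z
    exact hg n z
  let e : HomotopyEquiv C D :=
    { hom := F
      inv := G
      homotopyHomInvId :=
        -- `Homotopy` wants a map for every pair of degrees: `s i` transported along `i + 1 = j`,
        -- and zero elsewhere.
        { hom := fun i j => if h : i + 1 = j then
            ModuleCat.ofHom (s i) ≫ eqToHom (congrArg C.X h) else 0
          zero := fun i j h => dif_neg h
          comm := fun i => by
            cases i with
            | zero =>
              rw [Homotopy.dNext_zero_chainComplex, Homotopy.prevD_chainComplex, hC]
              ext z
              simpa using! sub_eq_iff_eq_add.1 (hs0 z).symm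
            | succ n =>
              rw [Homotopy.dNext_succ_chainComplex, Homotopy.prevD_chainComplex, hC, hC]
              ext z
              simpa [add_comm] using! sub_eq_iff_eq_add.1 (hs n z).symm }
      homotopyInvHomId :=
        { hom := fun i j => if h : i + 1 = j then
            ModuleCat.ofHom (t i) ≫ eqToHom (congrArg D.X h) else 0
          zero := fun i j h => dif_neg h
          comm := fun i => by
            cases i with
            | zero =>
              rw [Homotopy.dNext_zero_chainComplex, Homotopy.prevD_chainComplex, hD]
              ext z
              simpa using! sub_eq_iff_eq_add.1 (ht0 z).symm
            | succ n =>
              rw [Homotopy.dNext_succ_chainComplex, Homotopy.prevD_chainComplex, hD, hD]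
              ext z
              simpa [add_comm] using! sub_eq_iff_eq_add.1 (ht n z).symm } }
  exact ⟨e.toHomologyIso n⟩

/-- Isomorphic complexes have isomorphic homology. -/
theorem nonempty_homology_iso_of_linearEquiv {R : Type v} [CommRing R]
    {M N : ℕ → Type (max u v)}
    [∀ n, AddCommGroup (M n)] [∀ n, Module R (M n)] [∀ n, AddCommGroup (N n)]
    [∀ n, Module R (N n)] (dM : ∀ n, M (n + 1) →ₗ[R] M n) (dN : ∀ n, N (n + 1) →ₗ[R] N n)
    (hM : ∀ n, ModuleCat.ofHom (dM (n + 1)) ≫ ModuleCat.ofHom (dM n) = 0)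
    (hN : ∀ n, ModuleCat.ofHom (dN (n + 1)) ≫ ModuleCat.ofHom (dN n) = 0)
    (e : ∀ n, M n ≃ₗ[R] N n) (he : ∀ n z, dN n (e (n + 1) z) = e n (dM n z)) (n : ℕ) :
    Nonempty ((ChainComplex.of (fun n => ModuleCat.of R (M n)) (fun n => ModuleCat.ofHom (dM n))
        hM).homology n ≅
      (ChainComplex.of (fun n => ModuleCat.of R (N n)) (fun n => ModuleCat.ofHom (dN n))
        hN).homology n) :=
  nonempty_homology_iso_of_linear_homotopy dM dN hM hN (fun n => (e n).toLinearMap)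
    (fun n => (e n).symm.toLinearMap) he
    (fun n z => by
      apply (e n).injective
      simp [← he])
    (fun _ => 0) (fun _ => 0) (by simp) (by simp) (by simp) (by simp) n

namespace CarriedFamily

variable {T T' : Type*} {P : Type*} [Preorder P] (S : CarriedFamily.{u} T P)
  (S' : CarriedFamily.{u} T' P) (R : Type v) [CommRing R]

/-- Going to another carried family and back is homotopic to the identity. -/
theorem exists_homotopy : ∃ s : ∀ n : ℕ, (S.X n →₀ R) →ₗ[R] (S.X (n + 1) →₀ R),
    (∀ z, S.boundary R 0 (s 0 z) = S'.compMap R S 0 (S.compMap R S' 0 z) - z) ∧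
    ∀ n z, S.boundary R (n + 1) (s (n + 1) z) + s n (S.boundary R n z) =
      S'.compMap R S (n + 1) (S.compMap R S' (n + 1) z) - z := by
  -- The difference from the identity preserves carriers and vanishes after augmentation, so
  -- `nullHomotopy` applies.
  let k (n : ℕ) : (S.X n →₀ R) →ₗ[R] (S.X n →₀ R) :=
    S'.compMap R S n ∘ₗ S.compMap R S' n - LinearMap.id
  have hk (n : ℕ) (x : S.X n) : k n (Finsupp.single x 1) ∈ S.sub R n (S.carrier x) :=
    sub_mem (S'.compMap_mem S (S.compMap_mem S' (S.single_mem_sub le_rfl 1)))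
      (S.single_mem_sub le_rfl 1)
  have haug (z) : S.aug R (k 0 z) = 0 := by
    simp [k, aug_compMap]
  have hcomm (n : ℕ) (z) : S.boundary R n (k (n + 1) z) = k n (S.boundary R n z) := by
    simp [k, boundary_compMap]
  exact ⟨S.nullHomotopy S k, S.boundary_nullHomotopy_zero S hk haug,
    S.boundary_nullHomotopy_succ S hk haug hcomm⟩

theorem ofHom_boundary_comp (n : ℕ) : ModuleCat.ofHom (S.boundary R (n + 1)) ≫
    ModuleCat.ofHom (S.boundary R n) = 0 := by
  rw [← ModuleCat.ofHom_comp, S.boundary_comp]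
  rfl

theorem nonempty_homology_iso (n : ℕ) :
    Nonempty ((ChainComplex.of (fun n => ModuleCat.of R (S.X n →₀ R))
        (fun n => ModuleCat.ofHom (S.boundary R n)) (S.ofHom_boundary_comp R)).homology n ≅
      (ChainComplex.of (fun n => ModuleCat.of R (S'.X n →₀ R))
        (fun n => ModuleCat.ofHom (S'.boundary R n)) (S'.ofHom_boundary_comp R)).homology n) := by
  obtain ⟨s, hs0, hs⟩ := S.exists_homotopy S' R
  obtain ⟨t, ht0, ht⟩ := S'.exists_homotopy S R
  exact nonempty_homology_iso_of_linear_homotopy _ _ _ _ (S.compMap R S') (S'.compMap R S)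
    (S.boundary_compMap S') (S'.boundary_compMap S) s t hs0 hs ht0 ht n

end CarriedFamily

/-! ### The order complex as a carried family -/

/-- The order complex of a poset, carried by the largest elements of the chains. -/
def orderFamily (P : Type u) [PartialOrder P] : CarriedFamily.{u} P P where
  X := OrderSimplex P
  vert x := x
  vert_injective x := x.injective
  ext_vert h := RelEmbedding.ext h
  face := OrderSimplex.face
  vert_face _ _ _ := rfl
  carrier x := x (Fin.last _)
  carrier_face _ x := x.monotone (Fin.le_last _)
  apex H := H
  exists_vertex H := ⟨OrderEmbedding.ofStrictMono (fun _ => H) fun i j h => by omega, le_rfl, rfl⟩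
  exists_cone H {n} x hx hne :=
    ⟨OrderEmbedding.ofStrictMono (Fin.snoc x H : Fin (n + 2) → P) (by
        refine Fin.strictMono_iff_lt_succ.2 fun i => ?_
        induction i using Fin.lastCases with
        | last =>
          rw [Fin.succ_last, Fin.snoc_last, Fin.snoc_castSucc]
          exact lt_of_le_of_ne hx hne
        | cast i =>
          rw [Fin.succ_castSucc, Fin.snoc_castSucc, Fin.snoc_castSucc]
          exact x.strictMono (Fin.castSucc_lt_succ)), by simp, by
        ext k
        simp [OrderSimplex.face], by simp⟩

/-! ### Admissible chains as a carried family -/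

theorem IsElemAbelian.mono {p : ℕ} {G : Type u} [Group G] {H K : Subgroup G}
    (hH : IsElemAbelian p H) (h : K ≤ H) : IsElemAbelian p K :=
  ⟨fun x hx y hy => hH.1 x (h hx) y (h hy), fun x hx => hH.2 x (h hx)⟩

/-- The two subgroups commute, so multiplication is a homomorphism on `A × B` with image the join,
injective by disjointness. -/
theorem IsElemAbelian.card_sup {p : ℕ} {G : Type u} [Group G] {H A B : Subgroup G}
    (hH : IsElemAbelian p H) (hA : A ≤ H) (hB : B ≤ H) (hd : Disjoint A B) :
    Nat.card (A ⊔ B : Subgroup G) = Nat.card A * Nat.card B := by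
  have hc (a : A) (b : B) : Commute (A.subtype a) (B.subtype b) :=
    hH.1 _ (hA a.2) _ (hB b.2)
  have hr : (A.subtype.noncommCoprod B.subtype hc).range = A ⊔ B := by
    rw [MonoidHom.noncommCoprod_range, Subgroup.range_subtype, Subgroup.range_subtype]
  have hi : Function.Injective (A.subtype.noncommCoprod B.subtype hc) := by
    rw [MonoidHom.noncommCoprod_injective]
    simpa using hd
  rw [← hr, ← Nat.card_prod]
  exact Nat.card_congr (MonoidHom.ofInjective hi).symm.toEquiv

section

variable {p : ℕ} [hp : Fact p.Prime] {G : Type u} [Group G]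

theorem OrderPSubgroup.disjoint_of_not_le {V : OrderPSubgroup p G} {A : Subgroup G}
    (h : ¬ V.1 ≤ A) : Disjoint A V.1 := by
  have : Finite V.1 := Nat.finite_of_card_ne_zero (by rw [V.2]; exact hp.out.ne_zero)
  rw [disjoint_iff]
  have hdvd : Nat.card (A ⊓ V.1 : Subgroup G) ∣ p := by
    simpa only [V.2] using Subgroup.card_dvd_of_le (inf_le_right : A ⊓ V.1 ≤ V.1)
  rcases (Nat.dvd_prime hp.out).1 hdvd with h1 | h1
  · exact Subgroup.card_eq_one.1 h1
  · have := Subgroup.eq_of_le_of_card_ge (inf_le_right : A ⊓ V.1 ≤ V.1) (by rw [V.2, h1])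
    exact absurd (inf_eq_right.1 this) h

theorem OrderPSubgroup.ne_bot (V : OrderPSubgroup p G) : V.1 ≠ ⊥ := fun h => by
  have := V.2
  rw [h, Subgroup.card_bot] at this
  exact hp.out.one_lt.ne this

variable [Finite G] [LinearOrder (OrderPSubgroup p G)]

namespace QuillenPoset

theorem star_le (H : QuillenPoset p G) : H.star.1 ≤ H.1 := H.exists_isLeast.choose_spec.1

theorem star_le_of_le {H : QuillenPoset p G} {V : OrderPSubgroup p G} (h : V.1 ≤ H.1) :
    H.star ≤ V :=
  H.exists_isLeast.choose_spec.2 h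

theorem star_anti {H K : QuillenPoset p G} (h : H ≤ K) : K.star ≤ H.star :=
  star_le_of_le (H.star_le.trans h)

/-- A minimum that survives in a smaller set is still its minimum. This is how the stars of spans
are computed. -/
theorem star_eq {H K : QuillenPoset p G} (h : H ≤ K) (hK : K.star.1 ≤ H.1) : H.star = K.star :=
  le_antisymm (star_le_of_le hK) (star_anti h)

end QuillenPoset

namespace AdmissibleChain

/-- A strictly decreasing sequence of subgroups of order `p` such that each initial segment lies in
an elementary abelian subgroup whose smallest subgroup of order `p` is the last of the segment
spans an admissible chain. -/
@[simps W]
def ofVertices {n : ℕ} (V : Fin (n + 1) → OrderPSubgroup p G) (hV : StrictAnti V)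
    (H : Fin (n + 1) → QuillenPoset p G) (hH : ∀ j, (H j).star = V j)
    (hle : ∀ j k, k ≤ j → (V k).1 ≤ (H j).1) : AdmissibleChain p G n :=
  have hspan (j : Fin (n + 1)) : ⨆ k : Fin (n + 1), ⨆ _ : k ≤ j, (V k).1 ≤ (H j).1 :=
    iSup₂_le (hle j)
  have hmem {j k : Fin (n + 1)} (h : k ≤ j) : (V k).1 ≤ ⨆ k : Fin (n + 1), ⨆ _ : k ≤ j, (V k).1 :=
    le_iSup₂_of_le k h le_rfl
  let W (j : Fin (n + 1)) : QuillenPoset p G :=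
    ⟨⨆ k : Fin (n + 1), ⨆ _ : k ≤ j, (V k).1, ne_bot_of_le_ne_bot (V j).ne_bot (hmem le_rfl),
      (H j).2.2.mono (hspan j)⟩
  -- `W j` lies in `H j` and contains its star `V j`.
  have hstar (j : Fin (n + 1)) : (W j).star = V j :=
    (QuillenPoset.star_eq (hspan j) ((congrArg Subtype.val (hH j)).le.trans (hmem le_rfl))).trans
      (hH j)
  have hmono : Monotone W := fun i j h =>
    show (_ : Subgroup G) ≤ _ from iSup₂_le fun k hk => hmem (hk.trans h)
  -- Otherwise minimality of `V i` in `W i` would contradict the strict decrease.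
  have hnot (i : Fin n) : ¬ (V i.succ).1 ≤ (W i.castSucc).1 := fun h => by
    have := QuillenPoset.star_le_of_le h
    rw [hstar] at this
    exact (hV i.castSucc_lt_succ).not_ge this
  { W := W
    strictMono := Fin.strictMono_iff_lt_succ.2 fun i =>
      lt_of_le_of_ne (hmono i.castSucc_lt_succ.le) fun h =>
        hnot i (h ▸ hmem le_rfl)
    card_eq := fun j => by
      induction j using Fin.induction with
      | zero =>
        have : (W 0).1 = (V 0).1 :=
          le_antisymm (iSup₂_le fun k hk => by rw [Fin.le_zero_iff.1 hk]) (hmem le_rfl)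
        rw [this, (V 0).2]
        simp
      | succ i ih =>
        -- By `hnot` this join is direct, so the order grows by a factor `p`.
        have : (W i.succ).1 = (W i.castSucc).1 ⊔ (V i.succ).1 := by
          refine le_antisymm (iSup₂_le fun k hk => ?_)
            (sup_le (hmono i.castSucc_lt_succ.le) (hmem le_rfl))
          rcases hk.lt_or_eq with hk | rfl
          · exact le_sup_of_le_left (hmem (Fin.le_castSucc_iff.2 hk))
          · exact le_sup_right
        rw [this, (H i.succ).2.2.card_sup (le_trans (hmono i.castSucc_lt_succ.le) (hspan _))
          (hle _ _ le_rfl) (OrderPSubgroup.disjoint_of_not_le (hnot i)), ih, (V i.succ).2,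
          Fin.val_castSucc, Fin.val_succ, pow_succ _ ((i : ℕ) + 1)]
    not_star_le := fun i => by
      rw [hstar]
      exact hnot i }

theorem star_ofVertices {n : ℕ} (V : Fin (n + 1) → OrderPSubgroup p G) (hV : StrictAnti V)
    (H : Fin (n + 1) → QuillenPoset p G) (hH : ∀ j, (H j).star = V j)
    (hle : ∀ j k, k ≤ j → (V k).1 ≤ (H j).1) (j : Fin (n + 1)) :
    ((ofVertices V hV H hH hle).W j).star = V j := by
  refine (QuillenPoset.star_eq (K := H j) (iSup₂_le (hle j)) ?_).trans (hH j)
  rw [hH, ofVertices_W]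
  exact le_iSup₂_of_le j le_rfl le_rfl

variable {n : ℕ}

/-- Stars decrease weakly as subgroups grow; equality would put the star of `W (i + 1)` inside `W
i`. -/
theorem strictAnti_star (ρ : AdmissibleChain p G n) : StrictAnti fun k => (ρ.W k).star := by
  refine Fin.strictAnti_iff_succ_lt.2 fun i =>
    lt_of_le_of_ne (QuillenPoset.star_anti (ρ.strictMono i.castSucc_lt_succ).le) fun h => ?_
  refine ρ.not_star_le i ?_
  rw [show (ρ.W i.succ).star = _ from h]
  exact QuillenPoset.star_le _

theorem star_W_le (ρ : AdmissibleChain p G n) {j k : Fin (n + 1)} (h : k ≤ j) :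
    (ρ.W k).star.1 ≤ (ρ.W j).1 :=
  (QuillenPoset.star_le _).trans (ρ.strictMono.monotone h)

/-- The stars span an admissible chain of their own, whose terms lie in those of `ρ` and have the
same orders. Hence the stars determine the chain. -/
theorem W_eq_iSup (ρ : AdmissibleChain p G n) (j : Fin (n + 1)) :
    (ρ.W j).1 = ⨆ k : Fin (n + 1), ⨆ _ : k ≤ j, (ρ.W k).star.1 := by
  let σ := ofVertices _ ρ.strictAnti_star ρ.W (fun _ => rfl) fun j k h => ρ.star_W_le h
  have hle : (σ.W j).1 ≤ (ρ.W j).1 := iSup₂_le fun k h => ρ.star_W_le h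
  have hcard : Nat.card (ρ.W j).1 ≤ Nat.card (σ.W j).1 := by rw [ρ.card_eq, σ.card_eq]
  have h : (σ.W j).1 = (ρ.W j).1 := Subgroup.eq_of_le_of_card_ge hle hcard
  exact h.symm

theorem ext_star {ρ σ : AdmissibleChain p G n} (h : ∀ k, (ρ.W k).star = (σ.W k).star) : ρ = σ := by
  refine AdmissibleChain.ext (funext fun j => Subtype.ext ?_)
  simp only [W_eq_iSup, h]

/-- The admissible chain obtained by forgetting the subgroup `(Wᵢ)^*`. -/
def face (i : Fin (n + 2)) (ρ : AdmissibleChain p G (n + 1)) : AdmissibleChain p G n :=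
  ofVertices (fun k => (ρ.W (i.succAbove k)).star)
    (ρ.strictAnti_star.comp_strictMono (Fin.strictMono_succAbove i))
    -- The old terms serve as the ambient elementary abelian groups: their stars are exactly the
    -- vertices kept.
    (fun k => ρ.W (i.succAbove k)) (fun _ => rfl)
    fun _ _ h => ρ.star_W_le ((Fin.strictMono_succAbove i).monotone h)

/-- The chain obtained by appending a new top. -/
def snoc (ρ : AdmissibleChain p G n) (H : QuillenPoset p G) (hcard : Nat.card H.1 = p ^ (n + 2))
    (hle : ρ.W (Fin.last n) ≤ H) (hstar : ¬ H.star.1 ≤ (ρ.W (Fin.last n)).1) :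
    AdmissibleChain p G (n + 1) where
  W := Fin.snoc (α := fun _ => QuillenPoset p G) ρ.W H
  strictMono := Fin.strictMono_iff_lt_succ.2 fun i => by
    induction i using Fin.lastCases with
    | last =>
      rw [Fin.succ_last, Fin.snoc_last, Fin.snoc_castSucc]
      exact lt_of_le_of_ne hle fun h => hstar (h ▸ H.star_le)
    | cast i =>
      rw [Fin.succ_castSucc, Fin.snoc_castSucc, Fin.snoc_castSucc]
      exact ρ.strictMono i.castSucc_lt_succ
  card_eq i := by
    induction i using Fin.lastCases with
    | last => simpa using hcard
    | cast i => simpa using ρ.card_eq i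
  not_star_le i := by
    induction i using Fin.lastCases with
    | last => simpa using hstar
    | cast i =>
      rw [Fin.succ_castSucc, Fin.snoc_castSucc, Fin.snoc_castSucc]
      exact ρ.not_star_le i

/-- The chain obtained by deleting the top. -/
@[simps]
def init (ρ : AdmissibleChain p G (n + 1)) : AdmissibleChain p G n where
  W i := ρ.W i.castSucc
  strictMono := ρ.strictMono.comp Fin.strictMono_castSucc
  card_eq i := ρ.card_eq i.castSucc
  not_star_le i := ρ.not_star_le i.castSucc

end AdmissibleChain

variable (p G) in
/-- The admissible chains, with the subgroups `(Wᵢ)^*` as vertices and carried by their tops. -/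
def quillenFamily : CarriedFamily.{u} (OrderPSubgroup p G) (QuillenPoset p G) where
  X := AdmissibleChain p G
  vert ρ k := (ρ.W k).star
  vert_injective ρ := ρ.strictAnti_star.injective
  ext_vert := AdmissibleChain.ext_star
  face := AdmissibleChain.face
  vert_face i ρ k := AdmissibleChain.star_ofVertices _ _ _ _ _ k
  carrier ρ := ρ.W (Fin.last _)
  carrier_face i ρ := show (_ : Subgroup G) ≤ _ from
    iSup₂_le fun _ _ => ρ.star_W_le (Fin.le_last _)
  apex H := H.star
  exists_vertex H :=
    ⟨AdmissibleChain.ofVertices (fun _ => H.star) (fun i j h => by omega) (fun _ => H)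
      (fun _ => rfl) fun _ _ _ => H.star_le,
      show (_ : Subgroup G) ≤ _ from iSup₂_le fun _ _ => H.star_le,
      AdmissibleChain.star_ofVertices _ _ _ _ _ 0⟩
  -- As the top of `ρ` lies in `H`, the star of `H` is at most the last vertex, and it is smaller by
  -- `hne`. The sequence thus stays decreasing, with `H` as ambient group for the new last vertex.
  exists_cone H {n} ρ hρ hne := by
    let V : Fin (n + 2) → OrderPSubgroup p G :=
      Fin.snoc (α := fun _ => OrderPSubgroup p G) (fun k => (ρ.W k).star) H.star
    let K : Fin (n + 2) → QuillenPoset p G := Fin.snoc (α := fun _ => QuillenPoset p G) ρ.W H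
    have hK (j) : (K j).star = V j := by
      induction j using Fin.lastCases with
      | last => simp [K, V]
      | cast j => simp [K, V]
    have hVH (k) : (V k).1 ≤ H.1 := by
      induction k using Fin.lastCases with
      | last => simpa [V] using H.star_le
      | cast k => simpa [V] using (ρ.star_W_le (Fin.le_last k)).trans hρ
    have hV : StrictAnti V := by
      refine Fin.strictAnti_iff_succ_lt.2 fun i => ?_
      induction i using Fin.lastCases with
      | last =>
        simp only [Fin.succ_last, V, Fin.snoc_last, Fin.snoc_castSucc]
        exact lt_of_le_of_ne (QuillenPoset.star_anti hρ) hne.symm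
      | cast i =>
        simp only [Fin.succ_castSucc, V, Fin.snoc_castSucc]
        exact ρ.strictAnti_star i.castSucc_lt_succ
    have hle (j k) (h : k ≤ j) : (V k).1 ≤ (K j).1 := by
      induction j using Fin.lastCases with
      | last => simpa [K] using hVH k
      | cast j =>
        obtain ⟨k, rfl⟩ : ∃ k' : Fin (n + 1), k'.castSucc = k :=
          ⟨k.castPred (fun hk => by simp [hk, Fin.le_iff_val_le_val] at h; omega), by simp⟩
        simpa [K, V] using ρ.star_W_le (Fin.castSucc_le_castSucc_iff.1 h)
    refine ⟨AdmissibleChain.ofVertices V hV K hK hle,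
      show (_ : Subgroup G) ≤ _ from iSup₂_le fun k _ => hVH k,
      AdmissibleChain.ext_star fun k => ?_, ?_⟩
    · rw [AdmissibleChain.face, AdmissibleChain.star_ofVertices, AdmissibleChain.star_ofVertices]
      simp [V]
    · rw [AdmissibleChain.star_ofVertices]
      simp [V]

end

/-! ### Counting admissible chains with a given top -/

/-- The number of complements of a subspace over a finite field. -/
theorem Submodule.natCard_isCompl {K E : Type*} [Field K] [Finite K] [AddCommGroup E] [Module K E]
    [Finite E] (L : Submodule K E) :
    Nat.card {q : Submodule K E // IsCompl L q} =
      Nat.card K ^ ((Module.finrank K E - Module.finrank K L) * Module.finrank K L) := by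
  have : Module.Finite K E := Module.Finite.of_finite
  rw [Nat.card_congr L.isComplEquivProj]
  let res : (E →ₗ[K] L) →ₗ[K] (L →ₗ[K] L) := LinearMap.lcomp K L L.subtype
  have hsurj : Function.Surjective res := fun g => by
    obtain ⟨f, hf⟩ := LinearMap.exists_extend g
    exact ⟨f, hf⟩
  obtain ⟨f₀, hf₀⟩ := hsurj LinearMap.id
  -- Projections onto `L` are the extensions of the identity, a coset of the kernel of restriction.
  have e : {f : E →ₗ[K] L // ∀ x : L, f x = x} ≃ LinearMap.ker res :=
    (Equiv.subRight f₀).subtypeEquiv fun f => by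
      rw [LinearMap.mem_ker, Equiv.subRight_apply, map_sub, sub_eq_zero, hf₀]
      exact ⟨fun h => LinearMap.ext h, fun h x => LinearMap.congr_fun h x⟩
  have hrank := res.finrank_range_add_finrank_ker
  rw [LinearMap.range_eq_top.2 hsurj, finrank_top, Module.finrank_linearMap,
    Module.finrank_linearMap] at hrank
  rw [Nat.card_congr e, Module.natCard_eq_pow_finrank (K := K), Nat.sub_mul, ← hrank,
    Nat.add_sub_cancel_left]

theorem AddSubgroup.natCard_isCompl {p : ℕ} [hp : Fact p.Prime] {E : Type*} [AddCommGroup E]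
    [Module (ZMod p) E] {m : ℕ} (hcard : Nat.card E = p ^ (m + 1)) (V : AddSubgroup E)
    (hV : Nat.card V = p) : Nat.card {W : AddSubgroup E // IsCompl V W} = p ^ m := by
  have : Finite E := Nat.finite_of_card_ne_zero (by
    rw [hcard]
    exact pow_ne_zero _ hp.out.ne_zero)
  have : Module.Finite (ZMod p) E := Module.Finite.of_finite
  let φ : AddSubgroup E ≃o Submodule (ZMod p) E := AddSubgroup.toZModSubmodule p
  have h1 : Module.finrank (ZMod p) E = m + 1 := by
    refine Nat.pow_right_injective hp.out.two_le ?_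
    have := Module.natCard_eq_pow_finrank (K := ZMod p) (V := E)
    rw [Nat.card_zmod] at this
    exact this.symm.trans hcard
  have h2 : Module.finrank (ZMod p) (φ V) = 1 := by
    refine Nat.pow_right_injective hp.out.two_le ?_
    have := Module.natCard_eq_pow_finrank (K := ZMod p) (V := φ V)
    rw [Nat.card_zmod] at this
    exact this.symm.trans (hV.trans (pow_one p).symm)
  rw [Nat.card_congr (φ.toEquiv.subtypeEquiv (q := fun q => IsCompl (φ V) q) fun W =>
    φ.isCompl_iff), Submodule.natCard_isCompl, h1, h2, Nat.card_zmod]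
  simp

theorem Subgroup.natCard_isCompl {p : ℕ} [hp : Fact p.Prime] {E : Type*} [CommGroup E] {m : ℕ}
    (hE : ∀ x : E, x ^ p = 1) (hcard : Nat.card E = p ^ (m + 1)) (V : Subgroup E)
    (hV : Nat.card V = p) : Nat.card {W : Subgroup E // IsCompl V W} = p ^ m := by
  let _ := AddCommGroup.zmodModule (G := Additive E) (n := p) fun x => hE x.toMul
  let φ : Subgroup E ≃o AddSubgroup (Additive E) := Subgroup.toAddSubgroup
  exact (Nat.card_congr (φ.toEquiv.subtypeEquiv (q := fun q => IsCompl (φ V) q) fun W =>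
    φ.isCompl_iff)).trans (AddSubgroup.natCard_isCompl (E := Additive E) hcard (φ V) hV)

/-- A line is either inside a hyperplane or complementary to it; `card_sup` translates this into
orders. -/
theorem IsElemAbelian.isCompl_iff {p : ℕ} [hp : Fact p.Prime] {E : Type u} [Group E] {m : ℕ}
    (hE : IsElemAbelian p (⊤ : Subgroup E)) (hcard : Nat.card E = p ^ (m + 1))
    (V : OrderPSubgroup p E) (W : Subgroup E) :
    IsCompl V.1 W ↔ Nat.card W = p ^ m ∧ ¬ V.1 ≤ W := by
  have : Finite E := Nat.finite_of_card_ne_zero (by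
    rw [hcard]
    exact pow_ne_zero _ hp.out.ne_zero)
  constructor
  · intro h
    constructor
    · have := hE.card_sup le_top le_top h.disjoint
      rw [h.sup_eq_top, Subgroup.card_top, hcard, V.2, pow_succ'] at this
      exact (Nat.eq_of_mul_eq_mul_left hp.out.pos this).symm
    · exact fun hle => V.ne_bot (disjoint_self.1 (h.disjoint.mono_right hle))
  · rintro ⟨hW, hle⟩
    have hd := (OrderPSubgroup.disjoint_of_not_le hle).symm
    refine ⟨hd, codisjoint_iff.2 (Subgroup.eq_top_of_card_eq _ ?_)⟩
    rw [hE.card_sup le_top le_top hd, hW, V.2, hcard, pow_succ']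

section

variable {p : ℕ} [hp : Fact p.Prime] {G : Type u} [Group G] [Finite G]
  [LinearOrder (OrderPSubgroup p G)]

/-- Inside `H`, a vector space of dimension `n + 2` over the field with `p` elements, these are the
complements of the line `H^*`. -/
theorem QuillenPoset.natCard_not_star_le (H : QuillenPoset p G) {n : ℕ}
    (hcard : Nat.card H.1 = p ^ (n + 2)) :
    Nat.card {W : QuillenDim p G n // W.1 ≤ H ∧ ¬ H.star.1 ≤ W.1.1} = p ^ (n + 1) := by
  let _ : CommGroup H.1 :=
    { (inferInstance : Group H.1) with
      mul_comm := fun x y => Subtype.ext (H.2.2.1 x x.2 y y.2) }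
  let V : OrderPSubgroup p H.1 := ⟨H.star.1.subgroupOf H.1, 
    (Nat.card_congr (Subgroup.subgroupOfEquivOfLe H.star_le).toEquiv).trans H.star.2⟩
  have hpow (x : H.1) : x ^ p = 1 := Subtype.ext (H.2.2.2 x x.2)
  have hE : IsElemAbelian p (⊤ : Subgroup H.1) :=
    ⟨fun x _ y _ => mul_comm x y, fun x _ => hpow x⟩
  have hle (W : Subgroup G) : V.1 ≤ W.subgroupOf H.1 ↔ H.star.1 ≤ W :=
    (Subgroup.map_le_iff_le_comap (K := H.star.1.subgroupOf H.1)).symm.trans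
      (by rw [Subgroup.map_subgroupOf_eq_of_le H.star_le])
  refine (Nat.card_congr ?_).trans (Subgroup.natCard_isCompl hpow hcard V.1 V.2)
  refine
    { toFun := fun W => ⟨W.1.1.1.subgroupOf H.1, (hE.isCompl_iff hcard V _).2 ⟨?_, ?_⟩⟩
      invFun := fun K => ⟨⟨⟨K.1.map H.1.subtype, ?_, ?_⟩, ?_⟩, ?_, ?_⟩
      left_inv := ?_
      right_inv := ?_ }
  · exact (Nat.card_congr (Subgroup.subgroupOfEquivOfLe W.2.1).toEquiv).trans W.1.2
  · exact (hle _).not.2 W.2.2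
  · intro h
    have h1 := ((hE.isCompl_iff hcard V _).1 K.2).1
    rw [(Subgroup.map_eq_bot_iff_of_injective _ H.1.subtype_injective).1 h, Subgroup.card_bot] at h1
    exact (Nat.one_lt_pow (Nat.succ_ne_zero _) hp.out.one_lt).ne h1
  · exact H.2.2.mono (Subgroup.map_subtype_le _)
  · rw [Subgroup.card_subtype]
    exact ((hE.isCompl_iff hcard V _).1 K.2).1
  · exact Subgroup.map_subtype_le K.1
  · have h := ((hE.isCompl_iff hcard V _).1 K.2).2
    refine (hle _).not.1 ?_
    rwa [Subgroup.subgroupOf, Subgroup.comap_map_eq_self_of_injective H.1.subtype_injective]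
  · intro W
    exact Subtype.ext (Subtype.ext (Subtype.ext (Subgroup.map_subgroupOf_eq_of_le W.2.1)))
  · intro K
    exact Subtype.ext (Subgroup.comap_map_eq_self_of_injective H.1.subtype_injective _)

namespace AdmissibleChain

/-- An admissible chain with top `H` is an admissible chain whose top is a hyperplane of `H` not
containing `H^*`. -/
def topEquiv {n : ℕ} (H : QuillenDim p G (n + 1)) :
    {ρ : AdmissibleChain p G (n + 1) // ρ.top = H} ≃
      (W : {W : QuillenDim p G n // W.1 ≤ H.1 ∧ ¬ H.1.star.1 ≤ W.1.1}) ×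
        {ρ : AdmissibleChain p G n // ρ.top = W.1} where
  toFun ρ := ⟨⟨ρ.1.init.top, by
    obtain ⟨ρ, rfl⟩ := ρ
    exact ⟨(ρ.strictMono (Fin.castSucc_lt_last _)).le, ρ.not_star_le (Fin.last n)⟩⟩, ρ.1.init, rfl⟩
  invFun x := ⟨x.2.1.snoc H.1 H.2 (by
      rw [show x.2.1.W (Fin.last n) = x.1.1.1 from congrArg Subtype.val x.2.2]
      exact x.1.2.1) (by
      rw [show x.2.1.W (Fin.last n) = x.1.1.1 from congrArg Subtype.val x.2.2]
      exact x.1.2.2), Subtype.ext (by simp [snoc, top])⟩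
  left_inv := by
    rintro ⟨ρ, rfl⟩
    refine Subtype.ext (AdmissibleChain.ext (funext fun i => ?_))
    induction i using Fin.lastCases with
    | last => simp [snoc, top]
    | cast i => simp [snoc]
  right_inv := by
    rintro ⟨⟨W, hW⟩, ρ, hρ⟩
    obtain rfl : ρ.top = W := hρ
    have h : (ρ.snoc H.1 H.2 hW.1 hW.2).init = ρ :=
      AdmissibleChain.ext (funext fun i => by simp [snoc])
    refine Sigma.ext (Subtype.ext (congrArg top h)) ?_
    dsimp only
    congr!

instance {n : ℕ} : Finite (AdmissibleChain p G n) :=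
  Finite.of_injective AdmissibleChain.W fun _ _ => AdmissibleChain.ext

theorem natCard_top_eq {n : ℕ} (H : QuillenDim p G n) :
    Nat.card {ρ : AdmissibleChain p G n // ρ.top = H} = p ^ (n * (n + 1) / 2) := by
  induction n with
  | zero =>
    rw [zero_mul, Nat.zero_div, pow_zero, Nat.card_eq_one_iff_unique]
    refine ⟨⟨?_⟩, ⟨⟨⟨fun _ => H.1, fun i j h => by omega, fun i => ?_, fun i => i.elim0⟩, rfl⟩⟩⟩
    · rintro ⟨ρ, hρ⟩ ⟨σ, rfl⟩
      refine Subtype.ext (AdmissibleChain.ext (funext fun i => ?_))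
      rw [Fin.fin_one_eq_zero i]
      exact congrArg Subtype.val hρ
    · rw [Fin.fin_one_eq_zero i]
      exact H.2
  | succ n ih =>
    have := Fintype.ofFinite {W : QuillenDim p G n // W.1 ≤ H.1 ∧ ¬ H.1.star.1 ≤ W.1.1}
    rw [Nat.card_congr (topEquiv H), Nat.card_sigma, Finset.sum_congr rfl fun W _ => ih W.1,
      Finset.sum_const, Finset.card_univ, ← Nat.card_eq_fintype_card,
      QuillenPoset.natCard_not_star_le H.1 H.2, smul_eq_mul, ← pow_add]
    congr 1
    -- Rewriting the product this way lets the division by 2 split off the new exponent `n + 1`.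
    rw [show (n + 1) * (n + 1 + 1) = n * (n + 1) + (n + 1) * 2 by ring,
      Nat.add_mul_div_right _ _ two_pos, add_comm]

/-- Each fibre of `top` is numbered arbitrarily; no coefficient ring enters, so one indexing serves
all of them. -/
theorem exists_equiv (n : ℕ) : ∃ β : AdmissibleChain p G n ≃
    (_ : QuillenDim p G n) × Fin (p ^ (n * (n + 1) / 2)), ∀ ρ, (β ρ).1 = ρ.top :=
  ⟨(Equiv.sigmaFiberEquiv top).symm.trans (Equiv.sigmaCongrRight fun H =>
    Finite.equivFinOfCardEq (natCard_top_eq H)), fun _ => rfl⟩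

end AdmissibleChain

end

/-! ### The Euler–Poincaré formula and the Euler characteristic -/

theorem ModuleCat.finrank_homology_add {K : Type v} [Field K] (S : ShortComplex (ModuleCat.{u} K))
    [Module.Finite K S.X₂] :
    Module.finrank K S.homology + Module.finrank K (LinearMap.range S.f.hom) +
      Module.finrank K (LinearMap.range S.g.hom) = Module.finrank K S.X₂ := by
  have e : S.homology ≃ₗ[K] LinearMap.ker S.g.hom ⧸ LinearMap.range S.moduleCatToCycles :=
    S.moduleCatHomologyIso.toLinearEquiv
  have h1 := Submodule.finrank_quotient_add_finrank (LinearMap.range S.moduleCatToCycles)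
  have h2 : Module.finrank K (LinearMap.range S.moduleCatToCycles) =
      Module.finrank K (LinearMap.range S.f.hom) := by
    have h := LinearMap.range_comp S.moduleCatToCycles (LinearMap.ker S.g.hom).subtype
    rw [show (LinearMap.ker S.g.hom).subtype ∘ₗ S.moduleCatToCycles = S.f.hom from
      LinearMap.subtype_comp_codRestrict _ _ _] at h
    rw [h, Submodule.finrank_map_subtype_eq]
  rw [e.finrank_eq, ← h2, h1, add_comm]
  exact S.g.hom.finrank_range_add_finrank_ker

/-- The Euler–Poincaré formula for the first terms of a complex of vector spaces. -/
theorem ChainComplex.sum_finrank_homology {K : Type v} [Field K]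
    (C : ChainComplex (ModuleCat.{u} K) ℕ) [∀ n, Module.Finite K (C.X n)] (n : ℕ) :
    ∑ i ∈ Finset.range (n + 1), (-1 : ℤ) ^ i * (Module.finrank K (C.homology i) : ℤ) +
      (-1 : ℤ) ^ n * (Module.finrank K (LinearMap.range (C.d (n + 1) n).hom) : ℤ) =
      ∑ i ∈ Finset.range (n + 1), (-1 : ℤ) ^ i * (Module.finrank K (C.X i) : ℤ) := by
  have key (i j k : ℕ) (hi : (ComplexShape.down ℕ).prev j = i)
      (hk : (ComplexShape.down ℕ).next j = k) :
      Module.finrank K (C.homology j) + Module.finrank K (LinearMap.range (C.d i j).hom) +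
        Module.finrank K (LinearMap.range (C.d j k).hom) = Module.finrank K (C.X j) := by
    subst hi hk
    have : Module.Finite K (C.sc j).X₂ := inferInstanceAs (Module.Finite K (C.X j))
    exact ModuleCat.finrank_homology_add (C.sc j)
  induction n with
  | zero =>
    have h := key 1 0 0 (ChainComplex.prev ℕ 0) ChainComplex.next_nat_zero
    -- In degree 0 the outgoing differential is by convention `C.d 0 0`, which is zero.
    rw [C.shape 0 0 (by simp)] at h
    rw [ModuleCat.hom_zero, LinearMap.range_zero, finrank_bot, add_zero] at h
    simp only [zero_add, Finset.sum_range_one, pow_zero, one_mul]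
    exact_mod_cast h
  | succ n ih =>
    have h := key (n + 2) (n + 1) n (ChainComplex.prev ℕ (n + 1)) (ChainComplex.next_nat_succ n)
    rw [Finset.sum_range_succ, Finset.sum_range_succ _ (n + 1), ← ih, ← h, pow_succ]
    push_cast
    ring

theorem ChainComplex.homologyEulerChar_eq {K : Type v} [Field K]
    (C : ChainComplex (ModuleCat.{u} K) ℕ) [∀ n, Module.Finite K (C.X n)] (N : ℕ)
    (hN : ∀ n, N ≤ n → Module.finrank K (C.X n) = 0) :
    C.homologyEulerChar =
      ∑ n ∈ Finset.range N, (-1 : ℤ) ^ n * (Module.finrank K (C.X n) : ℤ) := by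
  have hhom (n : ℕ) (hn : N ≤ n) : Module.finrank K (C.homology n) = 0 := by
    have : Module.Finite K (C.sc n).X₂ := inferInstanceAs (Module.Finite K (C.X n))
    have h : _ = Module.finrank K (C.X n) := ModuleCat.finrank_homology_add (C.sc n)
    rw [hN n hn, Nat.add_eq_zero_iff, Nat.add_eq_zero_iff] at h
    exact h.1.1
  rw [HomologicalComplex.homologyEulerChar_eq_sum_finSet_of_finrankSupport_subset C
    (Finset.range N) ((GradedObject.finrankSupport_subset_iff _ _).2 fun n hn =>
      hhom n (by simpa using hn))]
  cases N with
  | zero => simp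
  | succ N =>
    have h := C.sum_finrank_homology N
    -- The source has rank zero, so the correction term of the truncated formula vanishes.
    have hr : Module.finrank K (LinearMap.range (C.d (N + 1) N).hom) = 0 :=
      Nat.eq_zero_of_le_zero ((LinearMap.finrank_range_le _).trans (hN _ le_rfl).le)
    rw [hr, Nat.cast_zero, mul_zero, add_zero] at h
    rw [← h]
    simp

theorem ChainComplex.homologyEulerChar_congr {K : Type v} [Field K]
    {C D : ChainComplex (ModuleCat.{u} K) ℕ} (h : ∀ n, Nonempty (C.homology n ≅ D.homology n)) :
    C.homologyEulerChar = D.homologyEulerChar :=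
  finsum_congr fun n => by
    obtain ⟨e⟩ := h n
    rw [e.toLinearEquiv.finrank_eq]

/-- Without a bound, `sSup` on the naturals would return its default value 0. -/
theorem bddAbove_ranks (p : ℕ) [hp : Fact p.Prime] (G : Type u) [Group G] [Finite G] :
    BddAbove {r : ℕ | ∃ H : Subgroup G, IsElemAbelian p H ∧ Nat.card H = p ^ r} := by
  refine ⟨Nat.card G, ?_⟩
  rintro r ⟨H, -, hH⟩
  exact (Nat.lt_pow_self hp.out.one_lt).le.trans (hH ▸ Subgroup.card_le_card_group H)

theorem QuillenDim.isEmpty_of_pRank_le {p : ℕ} [Fact p.Prime] {G : Type u} [Group G] [Finite G]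
    {n : ℕ} (h : pRank p G ≤ n) : IsEmpty (QuillenDim p G n) :=
  ⟨fun H => Nat.not_succ_le_self n
    (le_trans (le_csSup (bddAbove_ranks p G) ⟨H.1.1, H.1.2.2, H.2⟩) h)⟩

theorem AdmissibleChain.natCard_eq (p : ℕ) [Fact p.Prime] (G : Type u) [Group G] [Finite G]
    [LinearOrder (OrderPSubgroup p G)] (n : ℕ) :
    Nat.card (AdmissibleChain p G n) = p ^ (n * (n + 1) / 2) * Nat.card (QuillenDim p G n) := by
  obtain ⟨β, -⟩ := AdmissibleChain.exists_equiv (p := p) (G := G) n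
  rw [Nat.card_congr β, Nat.card_congr (Equiv.sigmaEquivProd _ _), Nat.card_prod, Nat.card_fin,
    mul_comm]

theorem posetEulerChar_quillenPoset (p : ℕ) [Fact p.Prime] (G : Type u) [Group G] [Finite G] :
    posetEulerChar (QuillenPoset p G) =
      ∑ n ∈ Finset.range (pRank p G),
        (-1 : ℤ) ^ n * (p : ℤ) ^ (n * (n + 1) / 2) * (Nat.card (QuillenDim p G n) : ℤ) := by
  classical
  -- Any total order will do, since the formula does not mention it.
  let _ : LinearOrder (OrderPSubgroup p G) := linearOrderOfSTO WellOrderingRel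
  let C := ChainComplex.of
    (fun n => ModuleCat.of ℚ ((quillenFamily p G).X n →₀ ℚ))
    (fun n => ModuleCat.ofHom ((quillenFamily p G).boundary ℚ n))
    ((quillenFamily p G).ofHom_boundary_comp ℚ)
  have hfin (n : ℕ) : Module.Finite ℚ (C.X n) :=
    inferInstanceAs (Module.Finite ℚ (AdmissibleChain p G n →₀ ℚ))
  have hrank (n : ℕ) : Module.finrank ℚ (C.X n) =
      p ^ (n * (n + 1) / 2) * Nat.card (QuillenDim p G n) := by
    have := Fintype.ofFinite (AdmissibleChain p G n)
    rw [← AdmissibleChain.natCard_eq, Nat.card_eq_fintype_card]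
    exact Module.finrank_finsupp_self ℚ (ι := AdmissibleChain p G n)
  have h : posetEulerChar (QuillenPoset p G) = C.homologyEulerChar :=
    ChainComplex.homologyEulerChar_congr
      ((orderFamily (QuillenPoset p G)).nonempty_homology_iso (quillenFamily p G) ℚ)
  rw [h, ChainComplex.homologyEulerChar_eq C (pRank p G) fun n hn => by
    have := QuillenDim.isEmpty_of_pRank_le (p := p) (G := G) hn
    rw [hrank, Nat.card_of_isEmpty, mul_zero]]
  refine Finset.sum_congr rfl fun n _ => ?_
  rw [hrank]
  push_cast
  ring

/-! ### Transport to the direct sums -/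

/-- The basis of `⨁_H R^{p^{n(n+1)/2}}` made of the vectors `quillenBasis`. -/
def quillenChainsBasis (R : Type v) [CommRing R] (p : ℕ) (G : Type u) [Group G] (n : ℕ) :
    Module.Basis ((_ : QuillenDim p G n) × Fin (p ^ (n * (n + 1) / 2))) R (QuillenChains R p G n) :=
  DFinsupp.basis fun _ : QuillenDim p G n => Pi.basisFun R (Fin (p ^ (n * (n + 1) / 2)))

theorem quillenChainsBasis_apply (R : Type v) [CommRing R] (p : ℕ) (G : Type u) [Group G] (n : ℕ)
    (x : (_ : QuillenDim p G n) × Fin (p ^ (n * (n + 1) / 2))) :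
    quillenChainsBasis R p G n x = quillenBasis R p G n x := by
  classical
  obtain ⟨H, k⟩ := x
  refine Module.Basis.apply_eq_iff.2 (Finsupp.ext fun ⟨K, l⟩ => ?_)
  change (DirectSum.lof R (QuillenDim p G n) (fun _ => Fin (p ^ (n * (n + 1) / 2)) → R) H
    (Pi.single k 1)) K l = _
  by_cases h : H = K
  · subst h
    rw [DirectSum.lof_apply, Finsupp.single_apply_left sigma_mk_injective, Finsupp.single_apply,
      Pi.single_apply]
    simp only [eq_comm]
  · rw [DirectSum.lof_eq_of, DirectSum.of_eq_of_ne _ _ _ (Ne.symm h), Finsupp.single_eq_of_ne]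
    · rfl
    · intro h'
      simp_all

end

theorem theorem3 {G : Type u} [Group G] [Finite G] (p : ℕ) [Fact p.Prime] :
    (∀ [LinearOrder (OrderPSubgroup p G)],
      -- for every admissible chain, the chain `ρᵢ` obtained by forgetting `(Wᵢ)^*`
      ∃ face : ∀ n : ℕ, Fin (n + 2) → AdmissibleChain p G (n + 1) → AdmissibleChain p G n,
        (∀ (n : ℕ) (i : Fin (n + 2)) (ρ : AdmissibleChain p G (n + 1)) (j : Fin (n + 1)),
          ((face n i ρ).W j).1 = ⨆ k : Fin (n + 1), ⨆ _ : k ≤ j, (ρ.W (i.succAbove k)).star.1) ∧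
      -- the chains with top `H` index the standard basis of the summand at `H`
      ∃ β : ∀ n : ℕ, AdmissibleChain p G n ≃
          (_ : QuillenDim p G n) × Fin (p ^ (n * (n + 1) / 2)),
        (∀ (n : ℕ) (ρ : AdmissibleChain p G n), (β n ρ).1 = ρ.top) ∧
        ∀ (R : Type v) [CommRing R],
          ∃ (d : ∀ n : ℕ, QuillenChains R p G (n + 1) →ₗ[R] QuillenChains R p G n)
            (hd : ∀ n : ℕ, ModuleCat.ofHom (d (n + 1)) ≫ ModuleCat.ofHom (d n) = 0),
            (∀ (n : ℕ) (ρ : AdmissibleChain p G (n + 1)),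
              d n (quillenBasis R p G (n + 1) (β (n + 1) ρ)) =
                ∑ i : Fin (n + 2),
                  (-1 : R) ^ (i : ℕ) • quillenBasis R p G n (β n (face n i ρ))) ∧
            ∀ n : ℕ, Nonempty
              ((ChainComplex.of (fun n => ModuleCat.of R (QuillenChains R p G n))
                  (fun n => ModuleCat.ofHom (d n)) hd).homology n ≅
                (orderChainComplex R (QuillenPoset p G)).homology n)) ∧
    posetEulerChar (QuillenPoset p G) =
      ∑ n ∈ Finset.range (pRank p G),
        (-1 : ℤ) ^ n * (p : ℤ) ^ (n * (n + 1) / 2) * (Nat.card (QuillenDim p G n) : ℤ) := by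
  refine ⟨?_, posetEulerChar_quillenPoset p G⟩
  intro _
  choose β hβ using AdmissibleChain.exists_equiv (p := p) (G := G)
  refine ⟨fun _ => AdmissibleChain.face, fun _ _ _ _ => rfl, β, hβ, fun R _ => ?_⟩
  let F := quillenFamily p G
  let e (n : ℕ) : QuillenChains R p G n ≃ₗ[R] (F.X n →₀ R) :=
    (quillenChainsBasis R p G n).repr ≪≫ₗ Finsupp.domLCongr (β n).symm
  have he (n : ℕ) (ρ : F.X n) : e n (quillenBasis R p G n (β n ρ)) = Finsupp.single ρ 1 := by
    rw [← quillenChainsBasis_apply, LinearEquiv.trans_apply, Module.Basis.repr_self]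
    refine (Finsupp.domLCongr_single (β n).symm _ _).trans ?_
    exact congrArg (fun σ => Finsupp.single σ (1 : R)) ((β n).symm_apply_apply ρ)
  have he' (n : ℕ) (ρ : F.X n) : (e n).symm (Finsupp.single ρ 1) =
      quillenBasis R p G n (β n ρ) := by
    rw [← he, LinearEquiv.symm_apply_apply]
  -- The simplicial boundary of admissible chains, conjugated by `e`.
  let d (n : ℕ) : QuillenChains R p G (n + 1) →ₗ[R] QuillenChains R p G n :=
    (e n).symm.toLinearMap ∘ₗ F.boundary R n ∘ₗ (e (n + 1)).toLinearMap
  have hd (n : ℕ) : ModuleCat.ofHom (d (n + 1)) ≫ ModuleCat.ofHom (d n) = 0 := by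
    ext z
    simp [d, SimplexFamily.boundary_boundary]
  refine ⟨d, hd, fun n ρ => ?_, fun n => ?_⟩
  · suffices h : ∀ σ : F.X (n + 1), (e n).symm (F.boundary R n (e (n + 1)
        (quillenBasis R p G (n + 1) (β (n + 1) σ)))) =
        ∑ i : Fin (n + 2), (-1 : R) ^ (i : ℕ) • quillenBasis R p G n (β n (F.face i σ)) from h ρ
    intro σ
    rw [he, SimplexFamily.boundary_single, map_sum]
    exact Finset.sum_congr rfl fun i _ => by rw [map_smul, he']
  · have hf (n : ℕ) (z : QuillenChains R p G (n + 1)) :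
        F.boundary R n (e (n + 1) z) = e n (d n z) :=
      ((e n).apply_symm_apply _).symm
    obtain ⟨h₁⟩ := nonempty_homology_iso_of_linearEquiv.{u, v} (M := QuillenChains R p G)
      (N := fun n => F.X n →₀ R) d (F.boundary R) hd (F.ofHom_boundary_comp R) e hf n
    obtain ⟨h₂⟩ := F.nonempty_homology_iso (orderFamily (QuillenPoset p G)) R n
    exact ⟨h₁ ≪≫ h₂⟩
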